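/- **Conventions.** Let $G$ be a countable group and $A$ a finite set with the discrete topology. $A^G$ carries the product topology and the shift action $(gx)(h)=x(g^{-1}h)$. A *subshift* is a closed $G$-invariant subset $X\subset A^G$. It is * *of finite type* if there are a finite $\Omega\subset G$ and $\mathcal A\subset A^\Omega$ with $X=\{x\in A^G:(gx)|_\Omega\in\mathcal A\text{ for all }g\in G\}$; * *splicable* if there is a finite $\Delta\subset G$ with $1_G\in\Delta$ such that, for every finite $B\subset G$ and all $x,y\in X$ with $x|_{B\Delta\setminus B}=y|_{B\Delta\setminus B}$, the configuration equal to $x$ on $B$ and to $y$ on $G\setminus B$ belongs to $X$; * *strongly irreducible* if there is a finite $\Delta\subset G$ with $1_G\in\Delta$ such that, for all finite $B_1,B_2\subset G$ with $B_1\Delta\cap B_2=\varnothing$ and all $x_1,x_2\in X$, there is $z\in X$ with $z|_{B_1}=x_1|_{B_1}$ and $z|_{B_2}=x_2|_{B_2}$; * *surjunctive* if every injective continuous $G$-equivariant map $X\to X$ is surjective. A *sofic approximation* of $G$ is a sequence $\Sigma=(d_j,\sigma_j)_{j\in\mathbb N}$ of positive integers $d_j\to\infty$ and maps $\sigma_j\colon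 G\to\mathrm{Sym}(d_j)$ such that $\eta_{d_j}(\sigma_j(s)\sigma_j(t),\sigma_j(st))\to0$ for all $s,t\in G$ and $\eta_{d_j}(\sigma_j(s),\sigma_j(t))\to1$ for all $s\ne t$ in $G$, where $\eta_d(\sigma,\tau)=\frac1d|\{a\in[d]:\sigma(a)\neq\tau(a)\}|$ and $[d]=\{1,\dots,d\}$. The countable group $G$ is *sofic* if it admits a sofic approximation. Let $X$ be a subshift and $\rho$ a metric on $X$ inducing its topology. For $\varphi,\psi\colon[d]\to X$ put $\rho_2(\varphi,\psi)=\big(\frac1d\sum_{a\in[d]}\rho(\varphi(a),\psi(a))^2\big)^{1/2}$ and $\rho_\infty(\varphi,\psi)=\max_{a\in[d]}\rho(\varphi(a),\psi(a))$. For a nonempty finite $F\subset G$, $\delta>0$ and $\sigma\colon G\to\mathrm{Sym}(d)$, let $\mathrm{Map}(X,\rho,F,\delta,\sigma)$ be the set of all $\varphi\colon[d]\to X$ with $\rho_2(\varphi\circ\sigma_s,s\varphi)<\delta$ for all $s\in F$, where $\sigma_s=\sigma(s)$ and $(s\varphi)(a)=s(\varphi(a))$. Let $N_\varepsilon(\cdot,\rho_\infty)$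 denote the maximal cardinality of a subset whose distinct points have $\rho_\infty$-distance at least $\varepsilon$. The *sofic topological entropy* is $$h_\Sigma(X,G)=\sup_{\varepsilon>0}\ \inf_{F}\ \inf_{\delta>0}\ \limsup_{j\to\infty}\frac1{d_j}\log N_\varepsilon\big(\mathrm{Map}(X,\rho,F,\delta,\sigma_j),\rho_\infty\big)\in[-\infty,+\infty],\qquad \log0=-\infty,$$ where $F$ ranges over the nonempty finite subsets of $G$; it does not depend on the choice of $\rho$. **Corollary.** Let $A$ be a finite set and let $G$ be a countable sofic group. 1. Let $X\subset A^G$ be a splicable, strongly irreducible subshift such that $h_\Sigma(X,G)\ge0$ for some sofic approximation $\Sigma$ of $G$. Then $X$ is surjunctive. 2. Every subshift $X\subset A^G$ of finite type is splicable; so (1) applies in particular to strongly irreducible subshifts of finite type. 3. (Gromov–Weiss) The full shift $A^G$ is surjunctive. -/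

import Mathlib

open SymbolicDynamics.FullShift Filter Topology
open scoped Pointwise ENNReal

noncomputable section

namespace SoficDynamics

/-! ### Sofic approximations -/

/-- The normalized Hamming distance `η_d(σ, τ) = |{a : σ a ≠ τ a}| / d` on `Sym(d)`. -/
def normHamming {d : ℕ} (σ τ : Equiv.Perm (Fin d)) : ℝ :=
  (hammingDist (fun a => σ a) (fun a => τ a) : ℝ) / (d : ℝ)

/-- A sofic approximation `Σ = (d_j, σ_j)` of a (countable) group `G`. -/
structure SoficApproximation (G : Type*) [Group G] where
  /-- The degrees `d_j`. -/
  d : ℕ → ℕ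
  d_pos : ∀ j, 0 < d j
  /-- The maps `σ_j : G → Sym(d_j)` (not assumed to be homomorphisms). -/
  σ : ∀ j, G → Equiv.Perm (Fin (d j))
  tendsto_d : Tendsto d atTop atTop
  asymp_mul : ∀ s t : G,
    Tendsto (fun j => normHamming (σ j s * σ j t) (σ j (s * t))) atTop (𝓝 0)
  asymp_free : ∀ s t : G, s ≠ t →
    Tendsto (fun j => normHamming (σ j s) (σ j t)) atTop (𝓝 1)

/-- A countable group is sofic if it admits a sofic approximation. -/
def IsSofic (G : Type*) [Group G] : Prop := Nonempty (SoficApproximation G)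

/-! ### Sofic topological entropy

In this section `G` acts on `X`, and `ρ` is a metric on `X`. -/

section Entropy

variable {G X : Type*} [Group G] [MulAction G X]

/-- The metric `ρ` induces the topology `T` of `X`. -/
def IsCompatible (T : TopologicalSpace X) (ρ : MetricSpace X) : Prop :=
  ρ.toUniformSpace.toTopologicalSpace = T

variable (ρ : MetricSpace X)

/-- `ρ₂(φ, ψ) = ((1/d) ∑_a ρ(φ(a), ψ(a))²)^{1/2}` on `X^d`. -/
def rhoTwo {d : ℕ} (φ ψ : Fin d → X) : ℝ :=
  √((1 / (d : ℝ)) * ∑ a, (ρ.dist (φ a) (ψ a)) ^ 2)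

/-- `ρ_∞(φ, ψ) = max_a ρ(φ(a), ψ(a))` on `X^d` (for `d > 0`). -/
def rhoInf {d : ℕ} (φ ψ : Fin d → X) : ℝ :=
  ⨆ a, ρ.dist (φ a) (ψ a)

/-- `Map(X, ρ, F, δ, σ)`: the maps `φ : [d] → X` with `ρ₂(φ ∘ σ_s, s φ) < δ` for all `s ∈ F`. -/
def approxMaps (F : Finset G) (δ : ℝ) {d : ℕ} (σ : G → Equiv.Perm (Fin d)) :
    Set (Fin d → X) :=
  {φ | ∀ s ∈ F, rhoTwo ρ (fun a => φ (σ s a)) (fun a => s • φ a) < δ}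

/-- `N_ε(M, ρ_∞)`: the maximal cardinality of a subset `Z` of `M ⊆ X^d` which is
`(ρ_∞, ε)`-separated, i.e. whose distinct points are at `ρ_∞`-distance at least `ε`.
It is `0` exactly when `M` is empty. -/
def sepNumber (ε : ℝ) {d : ℕ} (M : Set (Fin d → X)) : ℕ∞ :=
  ⨆ (Z : Set (Fin d → X)) (_ : Z ⊆ M) (_ : Z.Pairwise fun φ ψ => ε ≤ rhoInf ρ φ ψ), Z.encard

/-- The sofic topological entropy `h_Σ(X, G) ∈ [-∞, ∞]`, computed with the metric `ρ`; here
`ENNReal.log 0 = -∞`, so that levels `j` without any approximate map contribute `-∞`. -/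
def soficEntropy (S : SoficApproximation G) : EReal :=
  ⨆ (ε : ℝ) (_ : 0 < ε), ⨅ (F : Finset G) (_ : F.Nonempty), ⨅ (δ : ℝ) (_ : 0 < δ),
    limsup (fun j => ENNReal.log (sepNumber ρ ε (approxMaps ρ F δ (S.σ j)) : ℝ≥0∞)
      / ((S.d j : ℝ) : EReal)) atTop

end Entropy

/-- The system `(X, G)` is surjunctive if every injective continuous `G`-equivariant self-map of
`X` is surjective. -/
def IsSurjunctive (G X : Type*) [Group G] [MulAction G X] [TopologicalSpace X] : Prop :=
  ∀ f : X → X, Continuous f → (∀ (g : G) (x : X), f (g • x) = g • f x) →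
    Function.Injective f → Function.Surjective f

/-! ### Subshifts -/

section Subshifts

variable {A G : Type*} [TopologicalSpace A] [Group G]

/-- The shift action `(g x)(h) = x(g⁻¹ h)` of `G` on the points of a subshift. -/
instance shiftAction (X : MulSubshift A G) : MulAction G X.carrier where
  smul g x := ⟨mulShift g⁻¹ x.1, X.mapsTo g⁻¹ x.2⟩
  one_smul x := Subtype.ext (by
    change mulShift (1 : G)⁻¹ x.1 = x.1
    rw [inv_one, mulShift_one])
  mul_smul g h x := Subtype.ext (by
    change mulShift (g * h)⁻¹ x.1 = mulShift g⁻¹ (mulShift h⁻¹ x.1)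
    rw [mul_inv_rev, mulShift_mul])

/-- `X` is of finite type: `X = {x : (g x)|_Ω ∈ 𝒜 for all g}` for some finite `Ω ⊆ G` and
some set `𝒜 ⊆ A^Ω` of admissible patterns. -/
def IsFiniteType (X : MulSubshift A G) : Prop :=
  ∃ (Ω : Finset G) (P : Set (Ω → A)),
    X.carrier = {x | ∀ g : G, (fun ω : Ω => mulShift g⁻¹ x ω) ∈ P}

/-- `X` is splicable: for some finite `Δ ∋ 1`, whenever `B ⊆ G` is finite and `x, y ∈ X` agree on
`BΔ \ B`, the configuration equal to `x` on `B` and to `y` off `B` lies in `X`. -/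
def IsSplicable (X : MulSubshift A G) : Prop :=
  ∃ Δ : Finset G, 1 ∈ Δ ∧ ∀ B : Finset G, ∀ x ∈ X.carrier, ∀ y ∈ X.carrier,
    (∀ g ∈ ((B : Set G) * (Δ : Set G)) \ (B : Set G), x g = y g) →
    ∀ z : G → A, (∀ g ∈ B, z g = x g) → (∀ g ∉ B, z g = y g) → z ∈ X.carrier

/-- `X` is strongly irreducible: for some finite `Δ ∋ 1`, whenever `B₁, B₂ ⊆ G` are finite with
`B₁Δ ∩ B₂ = ∅` and `x₁, x₂ ∈ X`, some `z ∈ X` agrees with `x₁` on `B₁` and with `x₂` on `B₂`. -/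
def IsStronglyIrreducible (X : MulSubshift A G) : Prop :=
  ∃ Δ : Finset G, 1 ∈ Δ ∧ ∀ B₁ B₂ : Finset G,
    ((B₁ : Set G) * (Δ : Set G)) ∩ (B₂ : Set G) = ∅ →
    ∀ x₁ ∈ X.carrier, ∀ x₂ ∈ X.carrier,
      ∃ z ∈ X.carrier, (∀ g ∈ B₁, z g = x₁ g) ∧ (∀ g ∈ B₂, z g = x₂ g)

end Subshifts

end SoficDynamics

end

/-! Suppose `f : X → X` is injective and equivariant but not surjective. By compactness `f` is given
by a finite local rule, so is its inverse on the image, and some finite pattern of `p` never occurs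
in `f(X)`. On a sofic model `[d]`, count the labellings that look like configurations of `X` from
all points off a small set `B`.

Applying the local rule loses at most a factor `|A| ^ #B` (`exists_card_le_of_memory`) and gives
labellings in which the pattern occurs nowhere off `B`. By strong irreducibility and splicability
the pattern can be written independently near the points of a separated set `V` of size proportional
to `d` (`exists_modification`), so labellings avoiding it are rarer by a factor `(1 + 1/N) ^ #V`.
Each such round needs a larger window before than after. After `n` rounds the count for the largest
window is at most `|A| ^ (d + n * #B) * (N/(N+1)) ^ (n * #V)`, which is below `1` for large `n`
(`not_hasLocalModels`).

Hence it suffices that models exist for every window. Nonnegative entropy serves only to provide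
them. -/

namespace SoficDynamics

open Finset in
/-- If the maps `m v`, `v ∈ V`, are at most `N`-to-one on `M` and independently create the
properties `P v`, none of which holds on `W ⊆ M`, then `M` is larger than `W` by a factor
`(1 + 1 / N) ^ #V`. -/
theorem card_mul_pow_le_of_independent_moves {α ι : Type*} [DecidableEq α] [DecidableEq ι]
    (M : Finset α) (P : ι → α → Prop) (N : ℕ) (m : ι → α → α) (V : Finset ι)
    (hm : ∀ v ∈ V, ∀ w ∈ M, m v w ∈ M) (hP : ∀ v ∈ V, ∀ w ∈ M, P v (m v w))
    (hP' : ∀ v ∈ V, ∀ u ∈ V, u ≠ v → ∀ w ∈ M, ¬ P u w → ¬ P u (m v w))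
    (hN : ∀ v ∈ V, ∀ b, #{w ∈ M | m v w = b} ≤ N)
    (W : Finset α) (hWM : W ⊆ M) (hW : ∀ v ∈ V, ∀ w ∈ W, ¬ P v w) :
    #W * (N + 1) ^ #V ≤ N ^ #V * #M := by
  induction V using Finset.induction_on generalizing W with
  | empty => simpa using card_le_card hWM
  | insert v V hv ih =>
    have hvV : v ∈ insert v V := mem_insert_self v V
    have hsub : ∀ {u}, u ∈ V → u ∈ insert v V := fun h => mem_insert_of_mem h
    -- `W` together with its image under `m v` has at least `(1 + 1/N) * #W` elements and still
    -- avoids the remaining properties, so it replaces `W` in the induction.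
    have hdisj : Disjoint W (W.image (m v)) := by
      rw [disjoint_left]
      intro w hw hw'
      obtain ⟨w₀, hw₀, rfl⟩ := mem_image.1 hw'
      exact hW v hvV _ hw (hP v hvV w₀ (hWM hw₀))
    have hcard : #W ≤ N * #(W.image (m v)) := by
      refine card_le_mul_card_image W N fun b _ => le_trans (card_le_card ?_) (hN v hvV b)
      exact filter_subset_filter _ hWM
    have key := ih (fun u hu => hm u (hsub hu)) (fun u hu => hP u (hsub hu))
      (fun u hu t ht => hP' u (hsub hu) t (hsub ht)) (fun u hu => hN u (hsub hu))
      (W ∪ W.image (m v))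
      (union_subset hWM (by
        intro b hb
        obtain ⟨w, hw, rfl⟩ := mem_image.1 hb
        exact hm v hvV w (hWM hw)))
      (by
        intro u hu w hw
        rcases mem_union.1 hw with hw | hw
        · exact hW u (hsub hu) w hw
        · obtain ⟨w₀, hw₀, rfl⟩ := mem_image.1 hw
          exact hP' v hvV u (hsub hu) (fun h => hv (h ▸ hu)) w₀ (hWM hw₀)
            (hW u (hsub hu) w₀ hw₀))
    rw [card_union_of_disjoint hdisj] at key
    rw [card_insert_of_notMem hv]
    calc #W * (N + 1) ^ (#V + 1) = (N * #W + #W) * (N + 1) ^ #V := by ring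
      _ ≤ (N * #W + N * #(W.image (m v))) * (N + 1) ^ #V := by gcongr
      _ = N * ((#W + #(W.image (m v))) * (N + 1) ^ #V) := by ring
      _ ≤ N * (N ^ #V * #M) := by gcongr
      _ = N ^ (#V + 1) * #M := by ring

open Finset in
/-- A set of functions that pairwise agree off `B` has at most `|A| ^ #B` elements. -/
theorem card_le_pow_of_agree_off {D A : Type*} [Fintype A]
    (s : Finset (D → A)) (B : Finset D)
    (h : ∀ w ∈ s, ∀ w' ∈ s, ∀ a ∉ B, w a = w' a) : #s ≤ Fintype.card A ^ #B := by
  classical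
  have : #s ≤ #(univ : Finset (B → A)) := by
    refine card_le_card_of_injOn (fun w b => w b) (fun _ _ => mem_coe.2 (mem_univ _)) ?_
    intro w hw w' hw' hww
    funext a
    by_cases ha : a ∈ B
    · exact congrFun hww ⟨a, ha⟩
    · exact h w hw w' hw' a ha
  simpa using this

/-! ### Labellings of sofic models -/

section LocalModels

variable {G A D : Type*} [Group G]

/-- At the point `a`, the map `σ` is multiplicative and free on the finite set `H`. -/
def IsGoodAt (σ : G → Equiv.Perm D) (H : Finset G) (a : D) : Prop :=
  (∀ s ∈ H, ∀ t ∈ H, σ s (σ t a) = σ (s * t) a) ∧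
    ∀ s ∈ H, ∀ t ∈ H, σ s a = σ t a → s = t

/-- On the window `F`, the labelling `w` looks from the point `a` like a configuration in `X`. -/
def IsAdmissibleAt (σ : G → Equiv.Perm D) (X : Set (G → A)) (F : Finset G) (w : D → A)
    (a : D) : Prop :=
  ∃ x ∈ X, ∀ g ∈ F, x g = w (σ g⁻¹ a)

theorem IsGoodAt.one_apply {σ : G → Equiv.Perm D} {H : Finset G} {a : D}
    (h : IsGoodAt σ H a) (h1 : 1 ∈ H) : σ 1 a = a := by
  have := h.1 1 h1 1 h1
  rw [mul_one] at this
  exact (σ 1).injective this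

/-- If `h⁻¹` moves `a` to where `t⁻¹` moves `v`, then `v` sits at the position `h * t⁻¹` seen from
`a`. -/
theorem IsGoodAt.apply_eq_apply {σ : G → Equiv.Perm D} {H : Finset G} {a v : D}
    (ha : IsGoodAt σ H a) (hv : IsGoodAt σ H v) (h1 : 1 ∈ H) {h t e : G} (ht : t ∈ H)
    (ht' : t⁻¹ ∈ H) (hh : h⁻¹ ∈ H) (he : e⁻¹ ∈ H) (hth : (h * t⁻¹)⁻¹ ∈ H)
    (heq : σ h⁻¹ a = σ t⁻¹ v) : σ (h * t⁻¹ * e)⁻¹ a = σ e⁻¹ v := by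
  have h₁ : σ (h * t⁻¹)⁻¹ a = v := by
    have := hv.1 t ht t⁻¹ ht'
    rw [mul_inv_cancel, hv.one_apply h1, ← heq, ha.1 t ht h⁻¹ hh] at this
    rw [mul_inv_rev, inv_inv, this]
  rw [mul_inv_rev, ← ha.1 e⁻¹ he _ hth, h₁]

/-- The positions seen from `a` that lie in the window `F`, or in the `E`-neighbourhood of a point
of `V` whose `E`-neighbourhood meets the window `F`. -/
def InView (σ : G → Equiv.Perm D) (F E : Finset G) (V : Finset D) (a : D) (g : G) : Prop :=
  g ∈ F ∨ ∃ v ∈ V, ∃ h ∈ F, ∃ t ∈ E, ∃ e ∈ E, σ h⁻¹ a = σ t⁻¹ v ∧ g = h * t⁻¹ * e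

/-- `K`-patterns surrounded by the same letters on `E \ K` are interchangeable in `X`. -/
def IsInterchangeable (X : Set (G → A)) (K E : Finset G) : Prop :=
  ∀ g₀ : G, ∀ x ∈ X, ∀ y ∈ X, (∀ e ∈ E, e ∉ K → x (g₀ * e) = y e) →
    ∀ z : G → A, (∀ k ∈ K, z (g₀ * k) = y k) → (∀ g, (∀ k ∈ K, g ≠ g₀ * k) → z g = x g) →
    z ∈ X

/-- The pattern of `p` on `F₀` can be written into `K` whatever the letters on `E \ K`. -/
def IsWritable (X : Set (G → A)) (F₀ K E : Finset G) (p : G → A) : Prop :=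
  ∀ x ∈ X, ∃ y ∈ X, (∀ g ∈ F₀, y g = p g) ∧ ∀ g ∈ E, g ∉ K → y g = x g

/-- The condition on `InView` positions is preserved, so moves at different points of `V` can be
composed without shrinking the window. If the `E`-neighbourhood of `v` meets the window of `a`, it
is entirely in view and the new `K`-pattern can be spliced into the witness at `a`. Otherwise
separation of `V` keeps the change out of view. -/
theorem exists_modification {X : Set (G → A)} {F₀ K E F H : Finset G} {p : G → A}
    {σ : G → Equiv.Perm D} {B V : Finset D}
    (hint : IsInterchangeable X K E) (hwr : IsWritable X F₀ K E p)
    (hF₀K : F₀ ⊆ K) (hKE : K ⊆ E) (hE1 : 1 ∈ E) (hEF : E ⊆ F)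
    (hH1 : ∀ e ∈ E, e ∈ H) (hH2 : ∀ h ∈ F, ∀ t ∈ E, ∀ e ∈ E, (h * t⁻¹ * e)⁻¹ ∈ H)
    (hgood : ∀ a ∉ B, IsGoodAt σ H a)
    (hsep : ∀ u ∈ V, ∀ v ∈ V, ∀ s ∈ E, ∀ t ∈ E, σ s⁻¹ u = σ t⁻¹ v → u = v)
    {v : D} (hv : v ∈ V) (hVB : ∀ v ∈ V, v ∉ B) {w : D → A}
    (hw : ∀ a ∉ B, ∃ x ∈ X, ∀ g, InView σ F E V a g → x g = w (σ g⁻¹ a)) :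
    ∃ w' : D → A, (∀ a ∉ B, ∃ x ∈ X, ∀ g, InView σ F E V a g → x g = w' (σ g⁻¹ a)) ∧
      (∀ g ∈ F₀, w' (σ g⁻¹ v) = p g) ∧ ∀ b, (∀ k ∈ K, b ≠ σ k⁻¹ v) → w' b = w b := by
  classical
  have hFH : ∀ h ∈ F, h⁻¹ ∈ H := fun h hh => by simpa using hH2 h hh 1 hE1 1 hE1
  have hEH : ∀ e ∈ E, e⁻¹ ∈ H := fun e he => hFH e (hEF he)
  have hFEH : ∀ h ∈ F, ∀ t ∈ E, (h * t⁻¹)⁻¹ ∈ H := fun h hh t ht => by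
    simpa using hH2 h hh t ht 1 hE1
  have hpos : ∀ a ∉ B, ∀ u ∈ V, ∀ h ∈ F, ∀ t ∈ E, σ h⁻¹ a = σ t⁻¹ u →
      ∀ e ∈ E, σ (h * t⁻¹ * e)⁻¹ a = σ e⁻¹ u := fun a ha u hu h hh t ht heq e he =>
    (hgood a ha).apply_eq_apply (hgood u (hVB u hu)) (hH1 1 hE1) (hH1 t ht) (hEH t ht)
      (hFH h hh) (hEH e he) (hFEH h hh t ht) heq
  have hview : ∀ a g, InView σ F E V a g → g⁻¹ ∈ H := by
    rintro a g (hg | ⟨u, hu, h, hh, t, ht, e, he, -, rfl⟩)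
    · exact hFH g hg
    · exact hH2 h hh t ht e he
  obtain ⟨xv, hxv, hxvw⟩ := hw v (hVB v hv)
  obtain ⟨y, hy, hyp, hyx⟩ := hwr xv hxv
  -- Freeness at `v` makes the chosen `k` unique, so `w'` carries `y` on the copy of `K` at `v`.
  let w' : D → A := fun b =>
    if h : ∃ k ∈ K, b = σ k⁻¹ v then y h.choose else w b
  have hw'K : ∀ k ∈ K, w' (σ k⁻¹ v) = y k := by
    intro k hk
    have h : ∃ k' ∈ K, σ k⁻¹ v = σ k'⁻¹ v := ⟨k, hk, rfl⟩
    have h2 := h.choose_spec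
    have h3 := (hgood v (hVB v hv)).2 _ (hEH k (hKE hk)) _ (hEH _ (hKE h2.1)) h2.2
    simp only [w']
    rw [dif_pos h, ← inv_injective h3]
  have hw'off : ∀ b, (∀ k ∈ K, b ≠ σ k⁻¹ v) → w' b = w b := by
    intro b hb
    simp only [w']
    rw [dif_neg]
    rintro ⟨k, hk, h⟩
    exact hb k hk h
  refine ⟨w', fun a ha => ?_, fun g hg => ?_, hw'off⟩
  · obtain ⟨x, hx, hxw⟩ := hw a ha
    by_cases hmeet : ∃ h ∈ F, ∃ t ∈ E, σ h⁻¹ a = σ t⁻¹ v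
    · obtain ⟨h, hh, t, ht, heq⟩ := hmeet
      have hseen : ∀ e ∈ E, InView σ F E V a (h * t⁻¹ * e) := fun e he =>
        Or.inr ⟨v, hv, h, hh, t, ht, e, he, heq, rfl⟩
      have hposv := hpos a ha v hv h hh t ht heq
      let z : G → A := fun g => if ∃ k ∈ K, g = h * t⁻¹ * k then y ((h * t⁻¹)⁻¹ * g) else x g
      have hzK : ∀ k ∈ K, z (h * t⁻¹ * k) = y k := by
        intro k hk
        simp only [z]
        rw [if_pos ⟨k, hk, rfl⟩, inv_mul_cancel_left]
      have hzoff : ∀ g, (∀ k ∈ K, g ≠ h * t⁻¹ * k) → z g = x g := by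
        intro g hg
        simp only [z]
        rw [if_neg]
        rintro ⟨k, hk, h⟩
        exact hg k hk h
      refine ⟨z, hint (h * t⁻¹) x hx y hy (fun e he heK => ?_) z hzK hzoff, fun g hg => ?_⟩
      · rw [hxw _ (hseen e he), hposv e he, hyx e he heK, hxvw e (Or.inl (hEF he))]
      · by_cases hgK : ∃ k ∈ K, g = h * t⁻¹ * k
        · obtain ⟨k, hk, rfl⟩ := hgK
          rw [hzK k hk, hposv k (hKE hk), hw'K k hk]
        · push Not at hgK
          rw [hzoff g hgK, hxw g hg, hw'off]
          intro k hk hbad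
          rw [← hposv k (hKE hk)] at hbad
          have := (hgood a ha).2 _ (hview a g hg) _ (hH2 h hh t ht k (hKE hk)) hbad
          exact hgK k hk (inv_injective this)
    · push Not at hmeet
      refine ⟨x, hx, fun g hg => ?_⟩
      rw [hxw g hg, hw'off]
      intro k hk hbad
      rcases hg with hg | ⟨u, hu, h, hh, t, ht, e, he, heq, rfl⟩
      · exact hmeet g hg k (hKE hk) hbad
      · rw [hpos a ha u hu h hh t ht heq e he] at hbad
        obtain rfl := hsep u hu v hv e he k (hKE hk) hbad
        exact hmeet h hh t ht heq
  · rw [hw'K g (hF₀K hg), hyp g hg]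

open Finset in
/-- Labellings of `D` that look like configurations in `X` from all points off `B`. -/
noncomputable def localModels [Fintype A] [Fintype D] (σ : G → Equiv.Perm D)
    (X : Set (G → A)) (F : Finset G) (B : Finset D) : Finset (D → A) := by
  classical exact {w | ∀ a ∉ B, IsAdmissibleAt σ X F w a}

theorem mem_localModels [Fintype A] [Fintype D] {σ : G → Equiv.Perm D} {X : Set (G → A)}
    {F : Finset G} {B : Finset D} {w : D → A} :
    w ∈ localModels σ X F B ↔ ∀ a ∉ B, IsAdmissibleAt σ X F w a := by
  simp [localModels]

-- Writing `p` at the points of `V` gives independent moves, each at most `|A| ^ #K`-to-one because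
-- it changes only the copy of `K` at one point.
open Finset in
theorem card_mul_pow_le_card_localModels [Fintype A] [Nonempty A] [Fintype D]
    {X : Set (G → A)} {F₀ K E F F' H : Finset G} {p : G → A}
    {σ : G → Equiv.Perm D} {B V : Finset D}
    (hint : IsInterchangeable X K E) (hwr : IsWritable X F₀ K E p)
    (hF₀K : F₀ ⊆ K) (hKE : K ⊆ E) (hE1 : 1 ∈ E) (hEF : E ⊆ F)
    (hF' : ∀ h ∈ F, ∀ t ∈ E, ∀ e ∈ E, h * t⁻¹ * e ∈ F')
    (hH1 : ∀ e ∈ E, e ∈ H) (hH2 : ∀ g ∈ F', g⁻¹ ∈ H)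
    (hgood : ∀ a ∉ B, IsGoodAt σ H a)
    (hsep : ∀ u ∈ V, ∀ v ∈ V, ∀ s ∈ E, ∀ t ∈ E, σ s⁻¹ u = σ t⁻¹ v → u = v)
    (hVB : ∀ v ∈ V, v ∉ B) {W : Finset (D → A)} (hW : W ⊆ localModels σ X F' B)
    (hWp : ∀ w ∈ W, ∀ v ∉ B, ¬ ∀ g ∈ F₀, w (σ g⁻¹ v) = p g) :
    #W * (Fintype.card A ^ #K + 1) ^ #V ≤
      (Fintype.card A ^ #K) ^ #V * #(localModels σ X F B) := by
  classical
  -- `M` lies between the local models for `F'` and those for `F`, and is stable under all the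
  -- moves.
  let M : Finset (D → A) :=
    {w | ∀ a ∉ B, ∃ x ∈ X, ∀ g, InView σ F E V a g → x g = w (σ g⁻¹ a)}
  have hM : ∀ w, w ∈ M ↔ ∀ a ∉ B, ∃ x ∈ X, ∀ g, InView σ F E V a g → x g = w (σ g⁻¹ a) :=
    fun w => by simp [M]
  have hMX : M ⊆ localModels σ X F B := by
    intro w hw
    rw [mem_localModels]
    intro a ha
    obtain ⟨x, hx, hxw⟩ := (hM w).1 hw a ha
    exact ⟨x, hx, fun g hg => hxw g (Or.inl hg)⟩
  have hWM : W ⊆ M := by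
    intro w hw
    rw [hM]
    intro a ha
    obtain ⟨x, hx, hxw⟩ := mem_localModels.1 (hW hw) a ha
    refine ⟨x, hx, fun g hg => hxw g ?_⟩
    rcases hg with hg | ⟨u, hu, h, hh, t, ht, e, he, -, rfl⟩
    · simpa using hF' g hg 1 hE1 1 hE1
    · exact hF' h hh t ht e he
  have hex : ∀ v ∈ V, ∀ w ∈ M, ∃ w' ∈ M, (∀ g ∈ F₀, w' (σ g⁻¹ v) = p g) ∧
      ∀ b, (∀ k ∈ K, b ≠ σ k⁻¹ v) → w' b = w b := by
    intro v hv w hw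
    obtain ⟨w', h1, h2⟩ := exists_modification hint hwr hF₀K hKE hE1 hEF hH1
      (fun h hh t ht e he => hH2 _ (hF' h hh t ht e he)) hgood hsep hv hVB ((hM w).1 hw)
    exact ⟨w', (hM w').2 h1, h2⟩
  choose! m hmM hmp hmoff using hex
  refine (card_mul_pow_le_of_independent_moves M (fun v w => ∀ g ∈ F₀, w (σ g⁻¹ v) = p g)
    (Fintype.card A ^ #K) m V hmM hmp ?_ ?_ W hWM (fun v hv w hw => hWp w hw v (hVB v hv))).trans
    (Nat.mul_le_mul_left _ (card_le_card hMX))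
  · intro v hv u hu huv w hw hPw hP
    refine hPw fun g hg => ?_
    rw [← hP g hg, hmoff v hv w hw]
    intro k hk hbad
    exact huv (hsep u hu v hv g (hKE (hF₀K hg)) k (hKE hk) hbad)
  · intro v hv b
    refine (card_le_pow_of_agree_off _ (K.image fun k => σ k⁻¹ v) ?_).trans
      (Nat.pow_le_pow_right Fintype.card_pos card_image_le)
    intro w hw w' hw' c hc
    have hc' : ∀ k ∈ K, c ≠ σ k⁻¹ v := fun k hk h => hc (mem_image.2 ⟨k, hk, h.symm⟩)
    rw [mem_filter] at hw hw'
    rw [← hmoff v hv w hw.1 c hc', ← hmoff v hv w' hw'.1 c hc', hw.2, hw'.2]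

open Finset in
/-- The version on labellings of a cellular automaton with memory set `S` that is injective with
inverse memory set `T` loses at most the information on `B`. -/
theorem exists_card_le_of_memory [Fintype A] [Fintype D] {X : Set (G → A)}
    (hX : ∀ g, ∀ x ∈ X, mulShift g x ∈ X)
    {f : (G → A) → G → A} {S T F' F'' H : Finset G} {σ : G → Equiv.Perm D} {B : Finset D}
    (hS : ∀ x ∈ X, ∀ g, ∀ y ∈ X, (∀ s ∈ S, x (g * s) = y s) → f x g = f y 1)
    (hT : ∀ x ∈ X, ∀ y ∈ X, (∀ t ∈ T, f x t = f y t) → x 1 = y 1)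
    (hTF' : T ⊆ F') (h1 : 1 ∈ F'') (hF'' : ∀ g ∈ F', ∀ s ∈ S, g * s ∈ F'')
    (hH1 : 1 ∈ H) (hHS : ∀ s ∈ S, s⁻¹ ∈ H) (hHF : ∀ g ∈ F', g⁻¹ ∈ H)
    (hgood : ∀ a ∉ B, IsGoodAt σ H a) :
    ∃ W : Finset (D → A), W ⊆ localModels σ (f '' X) F' B ∧
      #(localModels σ X F'' B) ≤ Fintype.card A ^ #B * #W := by
  classical
  -- The local rule of `f`; by `hS` its value does not depend on the chosen `x`. The fallback `w a`
  -- is arbitrary.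
  let fhat : (D → A) → D → A := fun w a =>
    if h : ∃ x ∈ X, ∀ s ∈ S, x s = w (σ s⁻¹ a) then f h.choose 1 else w a
  have hfhat : ∀ w, ∀ a ∉ B, ∀ x ∈ X, (∀ g ∈ F'', x g = w (σ g⁻¹ a)) →
      ∀ g ∈ F', f x g = fhat w (σ g⁻¹ a) := by
    intro w a ha x hx hxw g hg
    have hloc : ∀ s ∈ S, x (g * s) = w (σ s⁻¹ (σ g⁻¹ a)) := by
      intro s hs
      rw [hxw _ (hF'' g hg s hs), (hgood a ha).1 _ (hHS s hs) _ (hHF g hg), mul_inv_rev]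
    have hex : ∃ x ∈ X, ∀ s ∈ S, x s = w (σ s⁻¹ (σ g⁻¹ a)) :=
      ⟨mulShift g x, hX g x hx, hloc⟩
    simp only [fhat]
    rw [dif_pos hex]
    refine hS x hx g _ hex.choose_spec.1 fun s hs => ?_
    rw [hloc s hs, hex.choose_spec.2 s hs]
  refine ⟨(localModels σ X F'' B).image fhat, ?_, ?_⟩
  · intro w hw
    obtain ⟨w, hwX, rfl⟩ := mem_image.1 hw
    rw [mem_localModels] at hwX ⊢
    intro a ha
    obtain ⟨x, hx, hxw⟩ := hwX a ha
    exact ⟨f x, ⟨x, hx, rfl⟩, hfhat w a ha x hx hxw⟩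
  -- The inverse rule on `T` recovers the letter at each point off `B`, so a fibre is free only on
  -- `B`.
  · refine card_le_mul_card_image _ _ fun b _ => card_le_pow_of_agree_off _ B ?_
    intro w hw w' hw' a ha
    rw [mem_filter, mem_localModels] at hw hw'
    obtain ⟨x, hx, hxw⟩ := hw.1 a ha
    obtain ⟨x', hx', hxw'⟩ := hw'.1 a ha
    have key := hT x hx x' hx' fun t ht => by
      rw [hfhat w a ha x hx hxw t (hTF' ht), hfhat w' a ha x' hx' hxw' t (hTF' ht), hw.2, hw'.2]
    rw [hxw 1 h1, hxw' 1 h1, inv_one, (hgood a ha).one_apply hH1] at key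
    exact key

open Finset in
/-- A maximal family of points off `B` with pairwise disjoint `E`-neighbourhoods. -/
theorem exists_separated [Fintype D] (σ : G → Equiv.Perm D) {E : Finset G} (hE : 1 ∈ E)
    (B : Finset D) : ∃ V : Finset D, (∀ v ∈ V, v ∉ B) ∧
      (∀ u ∈ V, ∀ v ∈ V, ∀ s ∈ E, ∀ t ∈ E, σ s⁻¹ u = σ t⁻¹ v → u = v) ∧
      Fintype.card D ≤ #B + #V * #E ^ 2 := by
  classical
  let C : Finset (Finset D) := {V | (∀ v ∈ V, v ∉ B) ∧
      ∀ u ∈ V, ∀ v ∈ V, ∀ s ∈ E, ∀ t ∈ E, σ s⁻¹ u = σ t⁻¹ v → u = v}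
  obtain ⟨V, hVC, hmax⟩ := C.exists_max_image card ⟨∅, by simp [C]⟩
  have hV := hVC
  simp only [C, mem_filter, mem_univ, true_and] at hV
  refine ⟨V, hV.1, hV.2, ?_⟩
  -- By maximality, the `E`-neighbourhood of any point off `B` meets that of some `v ∈ V`; each `v`
  -- accounts for at most `#E ^ 2` such points.
  have hcov : (univ : Finset D) ⊆
      B ∪ (V ×ˢ (E ×ˢ E)).image fun q => (σ q.2.1⁻¹).symm (σ q.2.2⁻¹ q.1) := by
    intro a _
    by_contra hcon
    rw [mem_union, not_or, mem_image] at hcon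
    obtain ⟨haB, hcon⟩ := hcon
    have hfar : ∀ v ∈ V, ∀ s ∈ E, ∀ t ∈ E, σ s⁻¹ a ≠ σ t⁻¹ v := by
      intro v hv s hs t ht h
      exact hcon ⟨(v, s, t), by simp [hv, hs, ht], by simp [← h]⟩
    have haV : a ∉ V := fun h => hfar a h 1 hE 1 hE rfl
    have hins : insert a V ∈ C := by
      simp only [C, mem_filter, mem_univ, true_and, mem_insert]
      refine ⟨?_, ?_⟩
      · rintro v (rfl | hv)
        · exact haB
        · exact hV.1 v hv
      · rintro u (rfl | hu) v (rfl | hv) s hs t ht h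
        · rfl
        · exact absurd h (hfar v hv s hs t ht)
        · exact absurd h.symm (hfar u hu t ht s hs)
        · exact hV.2 u hu v hv s hs t ht h
    have := hmax _ hins
    rw [card_insert_of_notMem haV] at this
    omega
  calc Fintype.card D = #(univ : Finset D) := card_univ.symm
    _ ≤ _ := card_le_card hcov
    _ ≤ #B + #((V ×ˢ (E ×ˢ E)).image _) := card_union_le _ _
    _ ≤ #B + #(V ×ˢ (E ×ˢ E)) := by gcongr; exact card_image_le
    _ = #B + #V * #E ^ 2 := by rw [card_product, card_product]; ring

end LocalModels

/-- There are sofic models of `G`, good off a small set `B`, with labellings that look like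
configurations in `X` from all points off `B`. -/
def HasLocalModels {G A : Type*} [Group G] (X : Set (G → A)) : Prop :=
  ∀ (F H : Finset G) (n : ℕ), ∃ (d : ℕ) (σ : G → Equiv.Perm (Fin d)) (B : Finset (Fin d)),
    0 < d ∧ n * B.card ≤ d ∧ (∀ a ∉ B, IsGoodAt σ H a) ∧
      ∃ w : Fin d → A, ∀ a ∉ B, IsAdmissibleAt σ X F w a

/-- The powers of `(N + 1) / N` are unbounded. The bound `2 ≤ n` later turns `n * #B ≤ d` into `#B ≤
d / 2`. -/
theorem exists_mul_pow_lt_succ_pow (N C : ℕ) : ∃ n, 2 ≤ n ∧ N ^ n * C < (N + 1) ^ n := by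
  rcases Nat.eq_zero_or_pos N with rfl | hN
  · exact ⟨2, le_rfl, by simp⟩
  · have hN' : (0 : ℝ) < N := by exact_mod_cast hN
    have h1 : (1 : ℝ) < (N + 1) / N := by rw [lt_div_iff₀ hN']; linarith
    obtain ⟨n, hn, hn2⟩ := (((tendsto_pow_atTop_atTop_of_one_lt h1).eventually_gt_atTop
      (C : ℝ)).and (eventually_ge_atTop 2)).exists
    refine ⟨n, hn2, ?_⟩
    rw [div_pow, lt_div_iff₀ (by positivity)] at hn
    rw [mul_comm]
    exact_mod_cast hn

/-! ### Iterated counting -/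

section Counting

variable {G A : Type*} [Group G]

open Finset in
theorem not_hasLocalModels [Fintype A] [Nonempty A] {X : Set (G → A)}
    (hX : ∀ g, ∀ x ∈ X, mulShift g x ∈ X) {f : (G → A) → G → A} (hfX : ∀ x ∈ X, f x ∈ X)
    {S T F₀ K E : Finset G} {p : G → A}
    (hS : ∀ x ∈ X, ∀ g, ∀ y ∈ X, (∀ s ∈ S, x (g * s) = y s) → f x g = f y 1)
    (hT : ∀ x ∈ X, ∀ y ∈ X, (∀ t ∈ T, f x t = f y t) → x 1 = y 1)
    (hint : IsInterchangeable X K E) (hwr : IsWritable X F₀ K E p)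
    (hF₀K : F₀ ⊆ K) (hKE : K ⊆ E) (hE1 : 1 ∈ E)
    (hp : ∀ x ∈ X, ¬ ∀ g ∈ F₀, f x g = p g) : ¬ HasLocalModels X := by
  classical
  intro hmod
  -- As `#B ≤ d / 2`, the separated set will satisfy `d ≤ q * #V`, hence `n * #B + d ≤ 2 * q * #V`.
  -- The number of rounds `n` is fixed before the model, since the windows and `H` depend on it.
  set q := 2 * #E ^ 2 with hq
  set N := Fintype.card A ^ #K with hN
  obtain ⟨n, hn2, hn⟩ := exists_mul_pow_lt_succ_pow N (Fintype.card A ^ (2 * q))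
  -- `nhd` is the margin needed for writing patterns, and the factor `S` the one needed for applying
  -- `f`.
  let nhd : Finset G → Finset G := fun F => F * E⁻¹ * E
  let next : Finset G → Finset G := fun F => nhd F ∪ nhd F * S
  let win : ℕ → Finset G := fun i => next^[i] (E ∪ T)
  have hnhd : ∀ F, F ⊆ nhd F := fun F g hg =>
    mem_mul.2 ⟨g, mem_mul.2 ⟨g, hg, 1, by simpa using hE1, mul_one g⟩, 1, hE1, mul_one g⟩
  have hnext : ∀ F, F ⊆ next F := fun F => (hnhd F).trans subset_union_left
  have hwin_succ : ∀ i, win (i + 1) = next (win i) := fun i =>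
    Function.iterate_succ_apply' next i _
  have hwin_mono : Monotone win := monotone_nat_of_le_succ fun i => by
    rw [hwin_succ]; exact hnext _
  have hwin : ∀ i, E ∪ T ⊆ win i := fun i => hwin_mono (Nat.zero_le i)
  obtain ⟨d, σ, B, hd, hB, hgood, w₀, hw₀⟩ :=
    hmod (win n) ((win n)⁻¹ ∪ E ∪ S⁻¹) n
  set H := (win n)⁻¹ ∪ E ∪ S⁻¹ with hH
  obtain ⟨V, hVB, hsep, hV⟩ := exists_separated σ hE1 B
  rw [Fintype.card_fin] at hV
  have hEH : ∀ e ∈ E, e ∈ H := fun e he => by simp [hH, he]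
  have hstep : ∀ i < n, #(localModels σ X (win (i + 1)) B) * (N + 1) ^ #V ≤
      Fintype.card A ^ #B * (N ^ #V * #(localModels σ X (win i) B)) := by
    intro i hi
    have hnhdH : ∀ g ∈ nhd (win i), g⁻¹ ∈ H := by
      intro g hg
      have : g ∈ win n := hwin_mono hi (by
        rw [hwin_succ]
        exact mem_union_left _ hg)
      simp [hH, this]
    obtain ⟨W, hW, hcard⟩ := exists_card_le_of_memory (H := H) (σ := σ) (B := B)
      (F' := nhd (win i)) (F'' := win (i + 1)) hX hS hT
      ((subset_union_right.trans (hwin i)).trans (hnhd _)) (hwin _ (mem_union_left _ hE1))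
      (fun g hg s hs => by
        rw [hwin_succ]
        exact mem_union_right _ (mul_mem_mul hg hs))
      (hEH 1 hE1) (fun s hs => by simp [hH, hs]) hnhdH hgood
    have hgrow := card_mul_pow_le_card_localModels (X := X) (F := win i) (F' := nhd (win i))
      (H := H) (σ := σ) (B := B) (V := V) (W := W) hint hwr hF₀K hKE hE1
      (subset_union_left.trans (hwin i))
      (fun h hh t ht e he => mul_mem_mul (mul_mem_mul hh (inv_mem_inv ht)) he)
      hEH hnhdH hgood hsep hVB
      (fun w hw => by
        rw [mem_localModels]
        intro a ha
        obtain ⟨_, ⟨x, hx, rfl⟩, hxw⟩ := mem_localModels.1 (hW hw) a ha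
        exact ⟨f x, hfX x hx, hxw⟩)
      (fun w hw v hv hwp => by
        obtain ⟨_, ⟨x, hx, rfl⟩, hxw⟩ := mem_localModels.1 (hW hw) v hv
        refine hp x hx fun g hg => ?_
        rw [hxw g (hnhd _ (hwin i (mem_union_left _ (hKE (hF₀K hg))))), hwp g hg])
    calc _ ≤ Fintype.card A ^ #B * #W * (N + 1) ^ #V := by gcongr
      _ = Fintype.card A ^ #B * (#W * (N + 1) ^ #V) := by ring
      _ ≤ _ := by gcongr
  have hiter : ∀ i ≤ n, #(localModels σ X (win i) B) * (N + 1) ^ (i * #V) ≤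
      Fintype.card A ^ (i * #B + d) * N ^ (i * #V) := by
    intro i
    induction i with
    | zero =>
      intro _
      have := card_le_univ (localModels σ X (win 0) B)
      simpa using this
    | succ i ih =>
      intro hi
      calc #(localModels σ X (win (i + 1)) B) * (N + 1) ^ ((i + 1) * #V)
          = #(localModels σ X (win (i + 1)) B) * (N + 1) ^ #V * (N + 1) ^ (i * #V) := by ring
        _ ≤ Fintype.card A ^ #B * (N ^ #V * #(localModels σ X (win i) B)) *
              (N + 1) ^ (i * #V) := Nat.mul_le_mul_right _ (hstep i hi)
        _ = Fintype.card A ^ #B * N ^ #V *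
              (#(localModels σ X (win i) B) * (N + 1) ^ (i * #V)) := by ring
        _ ≤ Fintype.card A ^ #B * N ^ #V * (Fintype.card A ^ (i * #B + d) * N ^ (i * #V)) :=
            Nat.mul_le_mul_left _ (ih (Nat.le_of_succ_le hi))
        _ = Fintype.card A ^ ((i + 1) * #B + d) * N ^ ((i + 1) * #V) := by ring
  have hpos : 1 ≤ #(localModels σ X (win n) B) :=
    card_pos.2 ⟨w₀, mem_localModels.2 hw₀⟩
  have h2B : 2 * #B ≤ d := (Nat.mul_le_mul_right _ hn2).trans hB
  have hdV : d ≤ q * #V := by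
    rw [hq]
    nlinarith
  have hV0 : #V ≠ 0 := by
    intro h
    rw [h] at hdV
    omega
  have hA : 0 < Fintype.card A := Fintype.card_pos
  have : (N + 1) ^ (n * #V) ≤ Fintype.card A ^ (2 * q * #V) * N ^ (n * #V) :=
    calc (N + 1) ^ (n * #V) ≤ #(localModels σ X (win n) B) * (N + 1) ^ (n * #V) :=
          Nat.le_mul_of_pos_left _ hpos
      _ ≤ _ := hiter n le_rfl
      _ ≤ _ := by
        refine Nat.mul_le_mul_right _ (Nat.pow_le_pow_right hA ?_)
        rw [mul_assoc]
        omega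
  rw [pow_mul, pow_mul, pow_mul N, ← mul_pow, mul_comm] at this
  exact absurd this (not_le.2 (Nat.pow_lt_pow_left hn hV0))

end Counting

/-! ### Finite dependence by compactness -/

section Compactness

theorem exists_finset_of_isClosed {K ι : Type*} [TopologicalSpace K] [CompactSpace K]
    {C : Set K} (hC : IsClosed C) {Z : ι → Set K} (hZ : ∀ i, IsClosed (Z i))
    (h : ∀ x ∈ C, ∃ i, x ∉ Z i) : ∃ F : Finset ι, ∀ x ∈ C, ∃ i ∈ F, x ∉ Z i := by
  obtain ⟨F, hF⟩ := hC.isCompact.elim_finite_subfamily_closed Z hZ (by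
    rw [Set.eq_empty_iff_forall_notMem]
    rintro x ⟨hx, hxZ⟩
    obtain ⟨i, hi⟩ := h x hx
    exact hi (Set.mem_iInter.1 hxZ i))
  refine ⟨F, fun x hx => ?_⟩
  by_contra! hcon
  exact Set.eq_empty_iff_forall_notMem.1 hF x ⟨hx, by simpa using hcon⟩

/-- If the discrete-valued function `u` only depends on the family `π i` of discrete-valued
functions, then it only depends on finitely many of them. -/
theorem exists_finset_determining {K ι A : Type*} [TopologicalSpace K] [CompactSpace K]
    [TopologicalSpace A] [DiscreteTopology A] {u : K → A} (hu : Continuous u) {π : K → ι → A}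
    (hπ : Continuous π) (h : ∀ x y, π x = π y → u x = u y) :
    ∃ F : Finset ι, ∀ x y, (∀ i ∈ F, π x i = π y i) → u x = u y := by
  have hπ' := fun i => (continuous_apply i).comp hπ
  obtain ⟨F, hF⟩ := exists_finset_of_isClosed
    (K := K × K) (C := {z | u z.1 ≠ u z.2}) (Z := fun i => {z | π z.1 i = π z.2 i})
    ((isClosed_discrete {z : A × A | z.1 ≠ z.2}).preimage
      ((hu.comp continuous_fst).prodMk (hu.comp continuous_snd)))
    (fun i => isClosed_eq ((hπ' i).comp continuous_fst) ((hπ' i).comp continuous_snd))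
    (fun z hz => by
      by_contra! hcon
      exact hz (h _ _ (funext fun i => by simpa using hcon i)))
  refine ⟨F, fun x y hxy => ?_⟩
  by_contra hne
  obtain ⟨i, hi, hne'⟩ := hF (x, y) hne
  exact hne' (hxy i hi)

end Compactness

/-! ### From subshifts to the counting argument -/

section Subshifts

variable {A G : Type*} [TopologicalSpace A] [Group G]

theorem smul_coe_apply {X : MulSubshift A G} (g : G) (x : X.carrier) (h : G) :
    (g • x).1 h = x.1 (g⁻¹ * h) := rfl

theorem isSurjunctive_of_hasLocalModels [Finite A] [DiscreteTopology A] {X : MulSubshift A G}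
    (hspl : IsSplicable X) (hirr : IsStronglyIrreducible X) (hmod : HasLocalModels X.carrier) :
    IsSurjunctive G X.carrier := by
  classical
  have := Fintype.ofFinite A
  intro f hf hequiv hinj p
  by_contra hp
  have hA : Nonempty A := ⟨p.1 1⟩
  have hcomp : CompactSpace X.carrier := isCompact_iff_compactSpace.1 X.isClosed.isCompact
  have hev : ∀ g : G, Continuous fun x : X.carrier => x.1 g := fun g =>
    (continuous_apply g).comp continuous_subtype_val
  have hfg : ∀ (x : X.carrier) (g : G), (f x).1 g = (f (g⁻¹ • x)).1 1 := by
    intro x g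
    rw [hequiv, smul_coe_apply, inv_inv, mul_one]
  -- `S` is a memory set of `f`, `T` one of its inverse on the image, and `F₀` supports a pattern of
  -- `p` absent from the image.
  obtain ⟨S, hS⟩ := exists_finset_determining ((hev 1).comp hf)
    (π := fun x : X.carrier => x.1) continuous_subtype_val
    (fun x y h => by rw [Subtype.ext h])
  obtain ⟨T, hT⟩ := exists_finset_determining (hev 1)
    (π := fun x : X.carrier => (f x).1) (continuous_subtype_val.comp hf)
    (fun x y h => by rw [hinj (Subtype.ext h)])
  obtain ⟨F₀, hF₀⟩ := exists_finset_of_isClosed (K := X.carrier) isClosed_univ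
    (Z := fun g => {x | (f x).1 g = p.1 g})
    (fun g => isClosed_eq ((hev g).comp hf) continuous_const)
    (fun x _ => by
      by_contra! hcon
      exact hp ⟨x, Subtype.ext (funext fun g => by simpa using hcon g)⟩)
  obtain ⟨Δ₁, hΔ₁, hspl⟩ := hspl
  obtain ⟨Δ₂, hΔ₂, hirr⟩ := hirr
  have hsub : ∀ {F Δ : Finset G}, 1 ∈ Δ → F ⊆ F * Δ := fun h g hg =>
    Finset.mem_mul.2 ⟨g, hg, 1, h, mul_one g⟩
  -- The collar `K \ F₁` leaves room for strong irreducibility and `E \ K`, with `E = K * Δ₁`, for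
  -- splicing. Inserting `1` ensures `1 ∈ E`.
  let F₁ := insert 1 F₀
  let K := F₁ * Δ₂
  let fX : (G → A) → G → A := fun x => if h : x ∈ X.carrier then (f ⟨x, h⟩).1 else x
  have hfX : ∀ x (h : x ∈ X.carrier), fX x = (f ⟨x, h⟩).1 := fun x h => dif_pos h
  refine not_hasLocalModels (X := X.carrier) (f := fX) (S := S) (T := T) (F₀ := F₀) (K := K)
    (E := K * Δ₁) (p := p.1) (fun g x hx => X.mapsTo g hx) ?_ ?_ ?_ ?_ ?_
    ((Finset.subset_insert _ _).trans (hsub hΔ₂)) (hsub hΔ₁)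
    (hsub hΔ₁ (hsub hΔ₂ (Finset.mem_insert_self 1 F₀))) ?_ hmod
  · intro x hx
    rw [hfX x hx]
    exact (f ⟨x, hx⟩).2
  · intro x hx g y hy hxy
    rw [hfX x hx, hfX y hy, hfg]
    refine hS _ _ fun s hs => ?_
    change x (g⁻¹⁻¹ * s) = y s
    rw [inv_inv, hxy s hs]
  · intro x hx y hy hxy
    rw [hfX x hx, hfX y hy] at hxy
    exact hT ⟨x, hx⟩ ⟨y, hy⟩ hxy
  · intro g₀ x hx y hy hxy z hz hzx
    have hy' : mulShift g₀⁻¹ y ∈ X.carrier := X.mapsTo _ hy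
    have hmem : ∀ g, g ∈ K.image (g₀ * ·) ↔ ∃ k ∈ K, g = g₀ * k := by
      intro g
      simp only [Finset.mem_image, eq_comm]
    refine hspl (K.image (g₀ * ·)) _ hy' x hx ?_ z ?_ ?_
    · rintro g ⟨⟨a, ha, δ, hδ, rfl⟩, hg⟩
      obtain ⟨k, hk, rfl⟩ := (hmem a).1 ha
      have hkδ : k * δ ∉ K := fun h => hg ((hmem _).2 ⟨k * δ, h, mul_assoc _ _ _⟩)
      simp only [mulShift_apply, mul_assoc, inv_mul_cancel_left]
      exact (hxy _ (Finset.mul_mem_mul hk hδ) hkδ).symm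
    · intro g hg
      obtain ⟨k, hk, rfl⟩ := (hmem g).1 hg
      rw [hz k hk, mulShift_apply, inv_mul_cancel_left]
    · intro g hg
      exact hzx g fun k hk h => hg ((hmem g).2 ⟨k, hk, h⟩)
  · intro x hx
    obtain ⟨z, hz, hzp, hzx⟩ := hirr F₁ ((K * Δ₁) \ K) (by
      rw [Set.eq_empty_iff_forall_notMem]
      rintro g ⟨hg, hg'⟩
      rw [← Finset.coe_mul] at hg
      exact (Finset.mem_sdiff.1 (Finset.mem_coe.1 hg')).2 (Finset.mem_coe.1 hg)) p.1 p.2 x hx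
    exact ⟨z, hz, fun g hg => hzp g (Finset.mem_insert_of_mem hg),
      fun g hg hgK => hzx g (Finset.mem_sdiff.2 ⟨hg, hgK⟩)⟩
  · intro x hx hcon
    obtain ⟨g, hg, hne⟩ := hF₀ ⟨x, hx⟩ (Set.mem_univ _)
    refine hne ?_
    have := hcon g hg
    rwa [hfX x hx] at this

/-- With `Δ = {1} ∪ Ω⁻¹Ω`, a translate of `Ω` meeting `B` lies in `BΔ`, where the spliced
configuration equals `x`; any other translate lies off `B`, where it equals `y`. -/
theorem IsFiniteType.isSplicable {X : MulSubshift A G} (h : IsFiniteType X) :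
    IsSplicable X := by
  classical
  obtain ⟨Ω, P, hX⟩ := h
  refine ⟨insert 1 (Ω⁻¹ * Ω), Finset.mem_insert_self _ _, ?_⟩
  intro B x hx y hy hxy z hzx hzy
  rw [hX] at hx hy ⊢
  intro g
  by_cases hmeet : ∃ ω ∈ Ω, g⁻¹ * ω ∈ B
  · obtain ⟨ω, hω, hB⟩ := hmeet
    convert hx g using 1
    funext ω'
    change z (g⁻¹ * ω') = x (g⁻¹ * ω')
    by_cases hB' : g⁻¹ * (ω' : G) ∈ B
    · exact hzx _ hB'
    · rw [hzy _ hB']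
      refine (hxy _ ⟨⟨g⁻¹ * ω, hB, ω⁻¹ * ω', ?_, by group⟩, hB'⟩).symm
      exact Finset.mem_insert_of_mem
        (Finset.mul_mem_mul (Finset.inv_mem_inv hω) ω'.2)
  · push Not at hmeet
    convert hy g using 1
    funext ω'
    exact hzy _ (hmeet ω' ω'.2)

theorem isSplicable_mulFullShift : IsSplicable (mulFullShift A G) :=
  ⟨{1}, Finset.mem_singleton_self 1, fun _ _ _ _ _ _ _ _ _ => Set.mem_univ _⟩

theorem isStronglyIrreducible_mulFullShift : IsStronglyIrreducible (mulFullShift A G) := by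
  classical
  refine ⟨{1}, Finset.mem_singleton_self 1, fun B₁ B₂ hB x₁ _ x₂ _ =>
    ⟨fun g => if g ∈ B₁ then x₁ g else x₂ g, Set.mem_univ _, fun g hg => if_pos hg,
      fun g hg => if_neg fun hg' => ?_⟩⟩
  exact Set.eq_empty_iff_forall_notMem.1 hB g ⟨⟨g, hg', 1, by simp, mul_one g⟩, hg⟩

end Subshifts

/-! ### Local models from sofic approximations -/

section Sofic

variable {G : Type*} [Group G]

open Finset in
/-- Along a sofic approximation, all but a small proportion of points are good. -/
theorem SoficApproximation.eventually_exists_isGoodAt (S : SoficApproximation G) (H : Finset G)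
    {ε : ℝ} (hε : 0 < ε) :
    ∀ᶠ j in atTop, ∃ B : Finset (Fin (S.d j)), (#B : ℝ) ≤ ε * S.d j ∧
      ∀ a ∉ B, IsGoodAt (S.σ j) H a := by
  classical
  -- Each pair in `H ×ˢ H` contributes two bad sets of density at most `c`; the `+ 1` covers empty
  -- `H`.
  set c : ℝ := ε / (2 * (#(H ×ˢ H) + 1)) with hc
  have hc0 : 0 < c := by positivity
  have hmul : ∀ᶠ j in atTop, ∀ z ∈ H ×ˢ H,
      normHamming (S.σ j z.1 * S.σ j z.2) (S.σ j (z.1 * z.2)) < c :=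
    (eventually_all_finset _).2 fun z _ => (S.asymp_mul z.1 z.2).eventually_lt_const hc0
  have hfree : ∀ᶠ j in atTop, ∀ z ∈ H ×ˢ H, z.1 ≠ z.2 →
      1 - c < normHamming (S.σ j z.1) (S.σ j z.2) :=
    (eventually_all_finset _).2 fun z _ => by
      by_cases hz : z.1 = z.2
      · exact Eventually.of_forall fun j h => absurd hz h
      · filter_upwards [(S.asymp_free z.1 z.2 hz).eventually_const_lt
          (show 1 - c < 1 by linarith)] with j hj _ using hj
  filter_upwards [hmul, hfree] with j h1 h2
  have hd : (0 : ℝ) < S.d j := by exact_mod_cast S.d_pos j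
  let B₁ : G × G → Finset (Fin (S.d j)) := fun z =>
    {a | S.σ j z.1 (S.σ j z.2 a) ≠ S.σ j (z.1 * z.2) a}
  let B₂ : G × G → Finset (Fin (S.d j)) := fun z =>
    {a | z.1 ≠ z.2 ∧ S.σ j z.1 a = S.σ j z.2 a}
  have hB₁ : ∀ z ∈ H ×ˢ H, (#(B₁ z) : ℝ) ≤ c * S.d j := by
    intro z hz
    have := h1 z hz
    rw [normHamming, div_lt_iff₀ hd] at this
    exact this.le
  have hB₂ : ∀ z ∈ H ×ˢ H, (#(B₂ z) : ℝ) ≤ c * S.d j := by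
    intro z hz
    by_cases hne : z.1 = z.2
    · simp only [B₂, hne, ne_eq, not_true_eq_false, false_and, filter_false, card_empty,
        Nat.cast_zero]
      positivity
    · have := h2 z hz hne
      rw [normHamming, lt_div_iff₀ hd] at this
      have hsum : (#(B₂ z) : ℝ) + hammingDist (fun a => S.σ j z.1 a) (fun a => S.σ j z.2 a) =
          S.d j := by
        have := card_filter_add_card_filter_not (s := (univ : Finset (Fin (S.d j))))
          (fun a => S.σ j z.1 a = S.σ j z.2 a)
        rw [card_univ, Fintype.card_fin] at this
        have hB : B₂ z = ({a | S.σ j z.1 a = S.σ j z.2 a} : Finset (Fin (S.d j))) := by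
          ext a; simp [B₂, hne]
        rw [hB, hammingDist]
        exact_mod_cast this
      linarith
  refine ⟨(H ×ˢ H).biUnion fun z => B₁ z ∪ B₂ z, ?_, ?_⟩
  · have h3 : (#((H ×ˢ H).biUnion fun z => B₁ z ∪ B₂ z) : ℝ) ≤
        ∑ z ∈ H ×ˢ H, (#(B₁ z ∪ B₂ z) : ℝ) := by exact_mod_cast card_biUnion_le
    have h4 : ∀ z ∈ H ×ˢ H, (#(B₁ z ∪ B₂ z) : ℝ) ≤ 2 * c * S.d j := by
      intro z hz
      have : (#(B₁ z ∪ B₂ z) : ℝ) ≤ #(B₁ z) + #(B₂ z) := by exact_mod_cast card_union_le _ _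
      linarith [hB₁ z hz, hB₂ z hz]
    have h5 := h3.trans (sum_le_card_nsmul _ _ _ h4)
    rw [nsmul_eq_mul] at h5
    refine h5.trans ?_
    have h6 : (#(H ×ˢ H) + 1 : ℝ) * (2 * c) = ε := by
      rw [hc]; field_simp
    have h7 : (#(H ×ˢ H) : ℝ) * (2 * c) ≤ ε := by rw [← h6]; gcongr; linarith
    rw [← mul_assoc]
    gcongr
  · intro a ha
    simp only [mem_biUnion, mem_union, not_exists, not_and, not_or] at ha
    refine ⟨fun s hs t ht => ?_, fun s hs t ht hst => ?_⟩
    · have := (ha (s, t) (mk_mem_product hs ht)).1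
      simpa [B₁] using this
    · have := (ha (s, t) (mk_mem_product hs ht)).2
      by_contra hne
      exact this (by simp [B₂, hne, hst])

open Finset in
theorem SoficApproximation.hasLocalModels_of_frequently {A : Type*} (S : SoficApproximation G)
    {X : Set (G → A)}
    (h : ∀ (F : Finset G) (ε : ℝ), 0 < ε → ∃ᶠ j in atTop, ∃ (B : Finset (Fin (S.d j)))
      (w : Fin (S.d j) → A), (#B : ℝ) ≤ ε * S.d j ∧ ∀ a ∉ B, IsAdmissibleAt (S.σ j) X F w a) :
    HasLocalModels X := by
  classical
  intro F H n
  -- Two exceptional sets of density at most `ε` are united, and `n * (2 * ε) ≤ 1`.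
  set ε : ℝ := 1 / (2 * (n + 1)) with hε
  have hε0 : 0 < ε := by positivity
  obtain ⟨j, ⟨B₁, w, hB₁, hw⟩, B₂, hB₂, hgood⟩ :=
    ((h F ε hε0).and_eventually (S.eventually_exists_isGoodAt H hε0)).exists
  refine ⟨S.d j, S.σ j, B₁ ∪ B₂, S.d_pos j, ?_,
    fun a ha => hgood a fun h => ha (mem_union_right _ h), w,
    fun a ha => hw a fun h => ha (mem_union_left _ h)⟩
  have h1 : (#(B₁ ∪ B₂) : ℝ) ≤ #B₁ + #B₂ := by exact_mod_cast card_union_le _ _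
  have h2 : (#(B₁ ∪ B₂) : ℝ) ≤ (2 * ε) * S.d j := by linarith
  have h3 : (n : ℝ) * (2 * ε) ≤ 1 := by
    rw [hε]
    field_simp
    linarith
  have h4 : (n : ℝ) * #(B₁ ∪ B₂) ≤ S.d j :=
    calc (n : ℝ) * #(B₁ ∪ B₂) ≤ n * ((2 * ε) * S.d j) := by gcongr
      _ = n * (2 * ε) * S.d j := by ring
      _ ≤ 1 * S.d j := by gcongr
      _ = S.d j := one_mul _
  exact_mod_cast h4

theorem SoficApproximation.hasLocalModels_univ {A : Type*} [Nonempty A]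
    (S : SoficApproximation G) : HasLocalModels (Set.univ : Set (G → A)) := by
  classical
  obtain ⟨a₀⟩ := ‹Nonempty A›
  refine S.hasLocalModels_of_frequently fun F ε hε => Frequently.of_forall fun j =>
    ⟨∅, fun _ => a₀, ?_, fun a _ => ⟨fun _ => a₀, Set.mem_univ _, fun _ _ => rfl⟩⟩
  simp only [Finset.card_empty, Nat.cast_zero]
  positivity

/-- If the sets of approximate maps were eventually empty for one pair `F`, `δ`, the convention `log
0 = -∞` would make the entropy `⊥`. -/
theorem frequently_approxMaps_nonempty {X : Type*} [MulAction G X] {ρ : MetricSpace X}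
    {S : SoficApproximation G} (h : 0 ≤ soficEntropy ρ S) {F : Finset G} (hF : F.Nonempty)
    {δ : ℝ} (hδ : 0 < δ) : ∃ᶠ j in atTop, (approxMaps ρ F δ (S.σ j)).Nonempty := by
  by_contra hcon
  rw [not_frequently] at hcon
  have hbot : soficEntropy ρ S = ⊥ := by
    rw [soficEntropy, eq_bot_iff]
    refine iSup₂_le fun ε _ => iInf₂_le_of_le F hF (iInf₂_le_of_le δ hδ ?_)
    refine limsup_le_of_le (by isBoundedDefault) ?_
    filter_upwards [hcon] with j hj
    have hsep : sepNumber ρ ε (approxMaps ρ F δ (S.σ j)) = 0 := by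
      rw [Set.not_nonempty_iff_eq_empty.1 hj, sepNumber]
      simp only [ENat.iSup_eq_zero]
      intro Z hZ _
      rw [Set.subset_empty_iff.1 hZ, Set.encard_empty]
    rw [hsep, ENat.toENNReal_zero, ENNReal.log_zero, EReal.bot_div_of_pos_ne_top]
    · exact_mod_cast S.d_pos j
    · exact EReal.coe_ne_top _
  rw [hbot] at h
  exact absurd h (by simp)

open Finset in
/-- Chebyshev's inequality for `ρ₂`. -/
theorem card_filter_dist_le {X : Type*} (ρ : MetricSpace X) {d : ℕ} (φ ψ : Fin d → X)
    {η δ : ℝ} (hη : 0 < η) (hδ : 0 < δ) (hd : 0 < d) (h : rhoTwo ρ φ ψ < δ) :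
    (#{a | η ≤ ρ.dist (φ a) (ψ a)} : ℝ) ≤ δ ^ 2 / η ^ 2 * d := by
  have hd' : (0 : ℝ) < d := by exact_mod_cast hd
  rw [rhoTwo, Real.sqrt_lt' hδ, one_div, inv_mul_lt_iff₀ hd'] at h
  have h1 : (#{a | η ≤ ρ.dist (φ a) (ψ a)} : ℝ) * η ^ 2 ≤ ∑ a, ρ.dist (φ a) (ψ a) ^ 2 :=
    calc (#{a | η ≤ ρ.dist (φ a) (ψ a)} : ℝ) * η ^ 2
        = ∑ a with η ≤ ρ.dist (φ a) (ψ a), η ^ 2 := by rw [sum_const, nsmul_eq_mul]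
      _ ≤ ∑ a with η ≤ ρ.dist (φ a) (ψ a), ρ.dist (φ a) (ψ a) ^ 2 :=
          sum_le_sum fun a ha => by
            have := (mem_filter.1 ha).2
            gcongr
      _ ≤ _ := sum_le_sum_of_subset_of_nonneg (filter_subset _ _) fun _ _ _ => sq_nonneg _
  rw [div_mul_eq_mul_div, le_div_iff₀ (by positivity)]
  linarith

variable {A : Type*} [TopologicalSpace A]

/-- `η` is a Lebesgue number of the clopen partition of the compact space `X` by the letter at `1`.
-/
theorem exists_eq_of_dist_lt [Finite A] [DiscreteTopology A] {X : MulSubshift A G}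
    {ρ : MetricSpace X.carrier}
    (hρ : IsCompatible (instTopologicalSpaceSubtype (t := Pi.topologicalSpace)) ρ) :
    ∃ η > 0, ∀ x y : X.carrier, ρ.dist x y < η → x.1 1 = y.1 1 := by
  have hc : @Continuous _ _ ρ.toUniformSpace.toTopologicalSpace _
      (fun x : X.carrier => x.1 1) := by
    rw [hρ]
    exact (continuous_apply 1).comp continuous_subtype_val
  have hK : @CompactSpace X.carrier ρ.toUniformSpace.toTopologicalSpace := by
    rw [hρ]
    exact isCompact_iff_compactSpace.1 X.isClosed.isCompact
  let _ : TopologicalSpace X.carrier := ρ.toUniformSpace.toTopologicalSpace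
  obtain ⟨η, hη, h⟩ := lebesgue_number_lemma_of_metric
    (c := fun a : A => {x : X.carrier | x.1 1 = a}) isCompact_univ
    (fun a => (isOpen_discrete {a}).preimage hc)
    (fun x _ => Set.mem_iUnion.2 ⟨x.1 1, rfl⟩)
  refine ⟨η, hη, fun x y hxy => ?_⟩
  obtain ⟨a, ha⟩ := h y (Set.mem_univ y)
  have h1 : x.1 1 = a := ha (Metric.mem_ball.2 hxy)
  have h2 : y.1 1 = a := ha (Metric.mem_ball_self hη)
  rw [h1, h2]

-- An approximate map `φ` yields the labelling `a ↦ φ(a)(1)`. Where `φ(σ(g⁻¹) a)` is `η`-close to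
-- `g⁻¹ • φ(a)` for all `g ∈ F`, the configuration `φ(a)` itself witnesses admissibility.
open Finset in
theorem hasLocalModels_of_soficEntropy_nonneg [Finite A] [DiscreteTopology A]
    {X : MulSubshift A G} {S : SoficApproximation G} {ρ : MetricSpace X.carrier}
    (hρ : IsCompatible (instTopologicalSpaceSubtype (t := Pi.topologicalSpace)) ρ)
    (h : 0 ≤ soficEntropy ρ S) : HasLocalModels X.carrier := by
  classical
  obtain ⟨η, hη, hdist⟩ := exists_eq_of_dist_lt hρ
  refine S.hasLocalModels_of_frequently fun F ε hε => ?_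
  set F₁ := insert 1 F⁻¹ with hF₁
  set c : ℝ := ε / #F₁ with hc
  have hF₁0 : (0 : ℝ) < #F₁ := by exact_mod_cast card_pos.2 (insert_nonempty _ _)
  have hc0 : 0 < c := by positivity
  -- With `δ = η * √c`, Chebyshev bounds the bad density by `c` for each `s ∈ F₁`, hence by `ε` in
  -- total.
  have hδ0 : 0 < η * √c := by positivity
  refine (frequently_approxMaps_nonempty h (insert_nonempty 1 F⁻¹) hδ0).mono ?_
  rintro j ⟨φ, hφ⟩
  refine ⟨F₁.biUnion fun s => {a | η ≤ ρ.dist (φ (S.σ j s a)) (s • φ a)}, fun a => (φ a).1 1,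
    ?_, ?_⟩
  · have h1 : (#(F₁.biUnion fun s => {a | η ≤ ρ.dist (φ (S.σ j s a)) (s • φ a)}) : ℝ) ≤
        ∑ s ∈ F₁, (#{a | η ≤ ρ.dist (φ (S.σ j s a)) (s • φ a)} : ℝ) := by
      exact_mod_cast card_biUnion_le
    refine h1.trans ((sum_le_card_nsmul _ _ (c * S.d j) fun s hs => ?_).trans_eq ?_)
    · have := card_filter_dist_le ρ _ _ hη hδ0 (S.d_pos j) (hφ s hs)
      rwa [mul_pow, Real.sq_sqrt hc0.le, mul_div_cancel_left₀ _ (by positivity)] at this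
    · rw [nsmul_eq_mul, hc]
      field_simp
  · intro a ha
    refine ⟨(φ a).1, (φ a).2, fun g hg => ?_⟩
    simp only [mem_biUnion, mem_filter, mem_univ, true_and, not_exists, not_and, not_le] at ha
    have := hdist _ _ (ha g⁻¹ (mem_insert_of_mem (inv_mem_inv hg)))
    rw [smul_coe_apply, inv_inv, mul_one] at this
    exact this.symm

end Sofic

end SoficDynamics

theorem corollary1p3 {A G : Type*} [Finite A] [TopologicalSpace A] [DiscreteTopology A]
    [Group G] [Countable G] (hG : SoficDynamics.IsSofic G) :
    -- every splicable, strongly irreducible subshift of nonnegative entropy is surjunctive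
    (∀ X : MulSubshift A G,
      SoficDynamics.IsSplicable X → SoficDynamics.IsStronglyIrreducible X →
      (∃ (S : SoficDynamics.SoficApproximation G) (ρ : MetricSpace X.carrier),
        SoficDynamics.IsCompatible
          (instTopologicalSpaceSubtype (t := Pi.topologicalSpace)) ρ ∧
        0 ≤ SoficDynamics.soficEntropy ρ S) →
      SoficDynamics.IsSurjunctive G X.carrier) ∧
    -- subshifts of finite type are splicable
    (∀ X : MulSubshift A G, SoficDynamics.IsFiniteType X → SoficDynamics.IsSplicable X) ∧
    -- the full shift is surjunctive
    SoficDynamics.IsSurjunctive G (mulFullShift A G).carrier := by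
  refine ⟨?_, fun X hX => hX.isSplicable, ?_⟩
  · rintro X hspl hirr ⟨S, ρ, hρ, hent⟩
    exact SoficDynamics.isSurjunctive_of_hasLocalModels hspl hirr
      (SoficDynamics.hasLocalModels_of_soficEntropy_nonneg hρ hent)
  · obtain ⟨S⟩ := hG
    rcases isEmpty_or_nonempty A with hA | hA
    · exact fun f _ _ _ y => isEmptyElim (y.1 1)
    · exact SoficDynamics.isSurjunctive_of_hasLocalModels
        SoficDynamics.isSplicable_mulFullShift SoficDynamics.isStronglyIrreducible_mulFullShift
        S.hasLocalModels_univ
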